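/- Let $L$ be a loop, i.e. a set with a (not necessarily associative) product with two-sided unit and with left and right divisions $\backslash$, $/$. The commutator and the associator are $[a,b]=(ba)\backslash(ab)$ and $(a,b,c)=(a(bc))\backslash((ab)c)$. The associator deviations of level $l\ge 0$ are functions $L^{l+3}\to L$ indexed by integers $\alpha_1,\ldots,\alpha_l$ with $0<\alpha_i\le i+2$: the deviation of level $0$ is the associator, and for $l\geq 1$ $$(a_1,\ldots,a_{l+3})_{\alpha_1,\ldots,\alpha_l}=\bigl(A(a_{\alpha_l})A(a_{\alpha_l+1})\bigr)\backslash A(a_{\alpha_l}a_{\alpha_l+1}),$$ where $A(x)=(a_1,\ldots,a_{\alpha_l-1},x,a_{\alpha_l+2},\ldots,a_{l+3})_{\alpha_1,\ldots,\alpha_{l-1}}$. A bracket of weight $n$ is an expression in $n$ indeterminates formed by repeatedly applying commutators, associators and associator deviations, in which every indeterminate appears exactly once. Let $\gamma_1L=L$ and, for $n>1$, let $\gamma_nL$ be the minimal normal subloop of $L$ containing all $[\gamma_pL,\gamma_qL]$ with $p+q\ge n$ and all $(\gamma_{p_1}L,\ldots,\gamma_{p_{l+3}}L)_{\alpha_1,\ldots,\alpha_l}$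 with $l\ge 0$ and $p_1+\cdots+p_{l+3}\ge n$ (all indices $p,q,p_i\geq 1$). The degree of a non-associative word $w$ in one letter (formed with the product and both divisions) is its image in $\mathbf Z$ under the homomorphism from the free loop on one generator to $\mathbf Z$ that sends the generator to $1$. For a normal subloop $K$ of $L$, the isolator $\sqrt K$ is the minimal normal subloop of $L$ containing all $x\in L$ such that $w(x)\in K$ for some word $w$ of non-zero degree. **Proposition.** For every loop $L$, the subloops $L_n=\sqrt{\gamma_nL}$, $n\ge 1$, form an $N$-sequence; that is, they are normal subloops with $L=L_1\supseteq L_2\supseteq\cdots$, and for every $n\geq 1$, every bracket of weight $n$ evaluated on arbitrary elements $x_i\in\sqrt{\gamma_{p_i}L}$ $(p_i\ge 1,\ 1\le i\le n)$ gives an element of $\sqrt{\gamma_{p_1+\cdots+p_n}L}$. -/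

import Mathlib

universe u

/-- A loop: a set with a product, a two-sided unit `1`, a left division `ldiv a b` (often written
`a \ b`, the unique solution `x` of `a * x = b`) and a right division `b / a` (the unique solution
`x` of `x * a = b`). No associativity is assumed. -/
class Loop (L : Type u) extends MulOneClass L, Div L where
  /-- left division -/
  ldiv : L → L → L
  mul_ldiv_cancel : ∀ a b : L, a * ldiv a b = b
  ldiv_mul_cancel : ∀ a b : L, ldiv a (a * b) = b
  rdiv_mul_cancel : ∀ a b : L, b / a * a = b
  mul_rdiv_cancel : ∀ a b : L, b * a / a = b

namespace Loop

variable {L : Type u} [Loop L]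

/-- The commutator `[a, b] = (b a) \ (a b)`. -/
def commutator (a b : L) : L := ldiv (b * a) (a * b)

/-- The associator `(a, b, c) = (a (b c)) \ ((a b) c)`. -/
def associator (a b c : L) : L := ldiv (a * (b * c)) (a * b * c)

/-- The tuple `(a₁, …, a_{k-1}, x, a_{k+2}, …)` obtained from a tuple `a` by replacing the two
neighbouring entries in the positions `k` and `k + 1` with the single entry `x`. -/
def contract {n : ℕ} (a : Fin (n + 1) → L) (k : Fin n) (x : L) : Fin n → L :=
  fun j => if j < k then a j.castSucc else if j = k then x else a j.succ

/-- The indices `α₁, …, α_l` of an associator deviation of level `l`, where `α_i` takes `i + 2`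
values. Everything is counted from `0` here: the `i`th index (`0 ≤ i < l`) lies in
`{0, …, i + 2}`. -/
abbrev DeviationIndex (l : ℕ) : Type := (i : Fin l) → Fin ((i : ℕ) + 3)

/-- The associator deviation `(a₁, …, a_{l+3})_{α₁, …, α_l}` of level `l`. Level zero is the
associator, and
`(a₁, …, a_{l+4})_{α₁, …, α_{l+1}} = (A (a_k) A (a_{k+1})) \ A (a_k a_{k+1})`, where `k = α_{l+1}`
and `A x = (a₁, …, a_{k-1}, x, a_{k+2}, …, a_{l+4})_{α₁, …, α_l}`. -/
def deviation : (l : ℕ) → DeviationIndex l → (Fin (l + 3) → L) → L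
  | 0, _, a => associator (a 0) (a 1) (a 2)
  | l + 1, α, a =>
    let k : Fin (l + 3) := α (Fin.last l)
    let A : L → L := fun x => deviation l (fun i => α i.castSucc) (contract a k x)
    ldiv (A (a k.castSucc) * A (a k.succ)) (A (a k.castSucc * a k.succ))

end Loop

/-- Subloops: subsets containing `1` and closed under the product and both divisions. -/
structure Subloop (L : Type u) [Loop L] where
  /-- the underlying set -/
  carrier : Set L
  one_mem' : (1 : L) ∈ carrier
  mul_mem' : ∀ {a b : L}, a ∈ carrier → b ∈ carrier → a * b ∈ carrier
  ldiv_mem' : ∀ {a b : L}, a ∈ carrier → b ∈ carrier → Loop.ldiv a b ∈ carrier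
  rdiv_mem' : ∀ {a b : L}, a ∈ carrier → b ∈ carrier → a / b ∈ carrier

namespace Subloop

variable {L : Type u} [Loop L]

instance : SetLike (Subloop L) L where
  coe := carrier
  coe_injective := by
    rintro ⟨s, _, _, _, _⟩ ⟨t, _, _, _, _⟩ h
    congr

/-- Subloops are ordered by inclusion. -/
instance : PartialOrder (Subloop L) := PartialOrder.ofSetLike (Subloop L) L

instance : Top (Subloop L) :=
  ⟨⟨Set.univ, trivial, fun _ _ => trivial, fun _ _ => trivial, fun _ _ => trivial⟩⟩

/-- A subloop `N` is normal if `x N = N x`, `x (y N) = (x y) N` and `(N x) y = N (x y)` for all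
`x` and `y` in the loop. -/
structure IsNormal (N : Subloop L) : Prop where
  comm : ∀ x : L, (fun n => x * n) '' (N : Set L) = (fun n => n * x) '' (N : Set L)
  left : ∀ x y : L, (fun n => x * (y * n)) '' (N : Set L) = (fun n => x * y * n) '' (N : Set L)
  right : ∀ x y : L, (fun n => n * x * y) '' (N : Set L) = (fun n => n * (x * y)) '' (N : Set L)

/-- The intersection of all normal subloops containing a set. -/
def normalClosure (S : Set L) : Subloop L where
  carrier := {x | ∀ N : Subloop L, N.IsNormal → S ⊆ N → x ∈ N}
  one_mem' := fun N _ _ => N.one_mem'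
  mul_mem' := fun ha hb N h1 h2 => N.mul_mem' (ha N h1 h2) (hb N h1 h2)
  ldiv_mem' := fun ha hb N h1 h2 => N.ldiv_mem' (ha N h1 h2) (hb N h1 h2)
  rdiv_mem' := fun ha hb N h1 h2 => N.rdiv_mem' (ha N h1 h2) (hb N h1 h2)

theorem mem_normalClosure {S : Set L} {x : L} :
    x ∈ normalClosure S ↔ ∀ N : Subloop L, N.IsNormal → S ⊆ N → x ∈ N := Iff.rfl

theorem subset_normalClosure (S : Set L) : S ⊆ normalClosure S :=
  fun _ hx _ _ h => h hx

theorem normalClosure_le {S : Set L} {N : Subloop L} (hN : N.IsNormal) (h : S ⊆ N) :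
    normalClosure S ≤ N := fun _ hx => hx N hN h

theorem mul_left_inj' {a b c : L} (h : a * b = a * c) : b = c := by
  rw [← Loop.ldiv_mul_cancel a b, h, Loop.ldiv_mul_cancel]

theorem mul_right_inj' {a b c : L} (h : b * a = c * a) : b = c := by
  rw [← Loop.mul_rdiv_cancel a b, h, Loop.mul_rdiv_cancel]

/-- The intersection of all normal subloops containing `S` is normal; by `normalClosure_le` it is
the minimal normal subloop containing `S`. -/
theorem isNormal_normalClosure (S : Set L) : (normalClosure S).IsNormal where
  comm x := by
    apply Set.Subset.antisymm
    · rintro _ ⟨n, hn, rfl⟩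
      refine ⟨x * n / x, fun N hN hS => ?_, Loop.rdiv_mul_cancel _ _⟩
      obtain ⟨m, hm, h⟩ := (hN.comm x).subset ⟨n, hn N hN hS, rfl⟩
      simp only at h
      rw [← h, Loop.mul_rdiv_cancel]
      exact hm
    · rintro _ ⟨n, hn, rfl⟩
      refine ⟨Loop.ldiv x (n * x), fun N hN hS => ?_, Loop.mul_ldiv_cancel _ _⟩
      obtain ⟨m, hm, h⟩ := (hN.comm x).superset ⟨n, hn N hN hS, rfl⟩
      simp only at h
      rw [← h, Loop.ldiv_mul_cancel]
      exact hm
  left x y := by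
    apply Set.Subset.antisymm
    · rintro _ ⟨n, hn, rfl⟩
      refine ⟨Loop.ldiv (x * y) (x * (y * n)), fun N hN hS => ?_, Loop.mul_ldiv_cancel _ _⟩
      obtain ⟨m, hm, h⟩ := (hN.left x y).subset ⟨n, hn N hN hS, rfl⟩
      simp only at h
      rw [← h, Loop.ldiv_mul_cancel]
      exact hm
    · rintro _ ⟨n, hn, rfl⟩
      refine ⟨Loop.ldiv y (Loop.ldiv x (x * y * n)), fun N hN hS => ?_, ?_⟩
      · obtain ⟨m, hm, h⟩ := (hN.left x y).superset ⟨n, hn N hN hS, rfl⟩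
        simp only at h
        rw [← h, Loop.ldiv_mul_cancel, Loop.ldiv_mul_cancel]
        exact hm
      · simp only [Loop.mul_ldiv_cancel]
  right x y := by
    apply Set.Subset.antisymm
    · rintro _ ⟨n, hn, rfl⟩
      refine ⟨n * x * y / (x * y), fun N hN hS => ?_, Loop.rdiv_mul_cancel _ _⟩
      obtain ⟨m, hm, h⟩ := (hN.right x y).subset ⟨n, hn N hN hS, rfl⟩
      simp only at h
      rw [← h, Loop.mul_rdiv_cancel]
      exact hm
    · rintro _ ⟨n, hn, rfl⟩
      refine ⟨n * (x * y) / y / x, fun N hN hS => ?_, ?_⟩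
      · obtain ⟨m, hm, h⟩ := (hN.right x y).superset ⟨n, hn N hN hS, rfl⟩
        simp only at h
        rw [← h, Loop.mul_rdiv_cancel, Loop.mul_rdiv_cancel]
        exact hm
      · simp only [Loop.rdiv_mul_cancel]

theorem IsNormal.mul_congr {N : Subloop L} (hN : N.IsNormal) {x y x' y' : L}
    (hx : ∃ n ∈ N, x' = x * n) (hy : ∃ n ∈ N, y' = y * n) :
    ∃ n ∈ N, x' * y' = x * y * n := by
  obtain ⟨n, hn, rfl⟩ := hx
  obtain ⟨m, hm, rfl⟩ := hy
  obtain ⟨m1, hm1, h1⟩ := (hN.left (x * n) y).subset ⟨m, hm, rfl⟩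
  obtain ⟨n1, hn1, h2⟩ := (hN.comm x).subset ⟨n, hn, rfl⟩
  obtain ⟨n2, hn2, h3⟩ := (hN.right x y).subset ⟨n1, hn1, rfl⟩
  obtain ⟨n3, hn3, h4⟩ := (hN.comm (x * y)).superset ⟨n2, hn2, rfl⟩
  obtain ⟨m2, hm2, h5⟩ := (hN.left (x * y) n3).superset ⟨m1, hm1, rfl⟩
  simp only at h1 h2 h3 h4 h5
  refine ⟨n3 * m2, N.mul_mem' hn3 hm2, ?_⟩
  rw [h5, h4, h3, h2, h1]

theorem IsNormal.symm {N : Subloop L} (hN : N.IsNormal) {x x' : L}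
    (hx : ∃ n ∈ N, x' = x * n) : ∃ n ∈ N, x = x' * n := by
  obtain ⟨n, hn, rfl⟩ := hx
  obtain ⟨m, hm, h⟩ := (hN.left x n).subset ⟨Loop.ldiv n 1, N.ldiv_mem' hn N.one_mem', rfl⟩
  refine ⟨m, hm, ?_⟩
  simp only [Loop.mul_ldiv_cancel, mul_one] at h
  exact h.symm

theorem IsNormal.trans {N : Subloop L} (hN : N.IsNormal) {x y z : L}
    (hx : ∃ n ∈ N, y = x * n) (hy : ∃ n ∈ N, z = y * n) : ∃ n ∈ N, z = x * n := by
  obtain ⟨n, hn, rfl⟩ := hx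
  obtain ⟨m, hm, rfl⟩ := hy
  obtain ⟨m1, hm1, h⟩ := (hN.left x n).superset ⟨m, hm, rfl⟩
  exact ⟨n * m1, N.mul_mem' hn hm1, h.symm⟩

theorem IsNormal.ldiv_congr {N : Subloop L} (hN : N.IsNormal) {x y x' y' : L}
    (hx : ∃ n ∈ N, x' = x * n) (hy : ∃ n ∈ N, y' = y * n) :
    ∃ n ∈ N, Loop.ldiv x' y' = Loop.ldiv x y * n := by
  have h1 := hN.mul_congr (hN.symm hx) ⟨1, N.one_mem', (mul_one (Loop.ldiv x' y')).symm⟩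
  rw [Loop.mul_ldiv_cancel] at h1
  obtain ⟨n, hn, h⟩ := hN.trans hy h1
  obtain ⟨m, hm, h2⟩ := (hN.left x (Loop.ldiv x y)).superset ⟨n, hn, rfl⟩
  simp only [Loop.mul_ldiv_cancel] at h2
  exact ⟨m, hm, mul_left_inj' (h.trans h2.symm)⟩

theorem IsNormal.deviation_congr {N : Subloop L} (hN : N.IsNormal) :
    ∀ (l : ℕ) (α : Loop.DeviationIndex l) (a b : Fin (l + 3) → L),
      (∀ i, ∃ n ∈ N, b i = a i * n) →
      ∃ n ∈ N, Loop.deviation l α b = Loop.deviation l α a * n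
  | 0, _, a, b, h => by
    exact hN.ldiv_congr (hN.mul_congr (h 0) (hN.mul_congr (h 1) (h 2)))
      (hN.mul_congr (hN.mul_congr (h 0) (h 1)) (h 2))
  | l + 1, α, a, b, h => by
    have key : ∀ (k : Fin (l + 3)) (x y : L), (∃ n ∈ N, y = x * n) →
        ∀ j, ∃ n ∈ N, Loop.contract b k y j = Loop.contract a k x j * n := by
      intro k x y hxy j
      unfold Loop.contract
      split_ifs
      exacts [h _, hxy, h _]
    have A := fun (x y : L) (hxy : ∃ n ∈ N, y = x * n) =>
      IsNormal.deviation_congr hN l (fun i => α i.castSucc) _ _ (key (α (Fin.last l)) x y hxy)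
    exact hN.ldiv_congr (hN.mul_congr (A _ _ (h _)) (A _ _ (h _)))
      (A _ _ (hN.mul_congr (h _) (h _)))

theorem deviation_eq_one : ∀ (l : ℕ) (α : Loop.DeviationIndex l) (a : Fin (l + 3) → L)
    (i : Fin (l + 3)), a i = 1 → Loop.deviation l α a = 1
  | 0, _, a, i, h => by
    have self : ∀ x : L, Loop.ldiv x x = 1 := fun x => by
      conv_lhs => arg 2; rw [← mul_one x]
      exact Loop.ldiv_mul_cancel x 1
    fin_cases i <;> simp_all [Loop.deviation, Loop.associator]
  | l + 1, α, a, i, h => by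
    have self : ∀ x : L, Loop.ldiv x x = 1 := fun x => by
      conv_lhs => arg 2; rw [← mul_one x]
      exact Loop.ldiv_mul_cancel x 1
    obtain ⟨k, hk⟩ : ∃ k : Fin (l + 3), k = α (Fin.last l) := ⟨_, rfl⟩
    have IH := deviation_eq_one l (fun i => α i.castSucc)
    simp only [Loop.deviation]
    rw [← hk]
    have hA1 : Loop.deviation l (fun i => α i.castSucc) (Loop.contract a k 1) = 1 :=
      IH _ k (by simp [Loop.contract])
    by_cases h1 : i = k.castSucc
    · subst h1
      rw [h, hA1, one_mul, one_mul, self]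
    by_cases h2 : i = k.succ
    · subst h2
      rw [h, hA1, mul_one, mul_one, self]
    have hA : ∀ x, Loop.deviation l (fun i => α i.castSucc) (Loop.contract a k x) = 1 := by
      intro x
      rcases lt_or_ge i k.castSucc with h3 | h3
      · refine IH _ ⟨i, by have := k.isLt; simp [Fin.lt_def] at h3; omega⟩ ?_
        have : (⟨i, by have := k.isLt; simp [Fin.lt_def] at h3; omega⟩ : Fin (l + 3)) < k := h3
        simp only [Loop.contract, if_pos this]
        exact h
      · have h4 : (k : ℕ) + 1 < i := by
          simp [Fin.ext_iff, Fin.le_def] at h1 h2 h3; omega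
        refine IH _ ⟨i - 1, by have := i.isLt; omega⟩ ?_
        have e : (⟨i - 1, by have := i.isLt; omega⟩ : Fin (l + 3)).succ = i := by
          ext; simp; omega
        have n1 : ¬ (⟨i - 1, by have := i.isLt; omega⟩ : Fin (l + 3)) < k := by
          simp [Fin.lt_def]; omega
        have n2 : (⟨i - 1, by have := i.isLt; omega⟩ : Fin (l + 3)) ≠ k := by
          simp [Fin.ext_iff]; omega
        simp only [Loop.contract, if_neg n1, if_neg n2, e]
        exact h
    rw [hA, hA, hA, one_mul, self]

/-- A deviation with one argument in a normal subloop lies in that subloop. -/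
theorem IsNormal.deviation_mem {N : Subloop L} (hN : N.IsNormal) (l : ℕ)
    (α : Loop.DeviationIndex l) (a : Fin (l + 3) → L) (i : Fin (l + 3)) (hi : a i ∈ N) :
    Loop.deviation l α a ∈ N := by
  classical
  obtain ⟨n, hn, h⟩ := hN.deviation_congr l α (Function.update a i 1) a (by
    intro j
    by_cases hj : j = i
    · subst hj
      exact ⟨a j, hi, by simp⟩
    · exact ⟨1, N.one_mem', by simp [hj]⟩)
  rw [deviation_eq_one l α (Function.update a i 1) i (Function.update_self i 1 a), one_mul] at h
  rw [h]
  exact hn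

/-- A commutator with one argument in a normal subloop lies in that subloop. -/
theorem IsNormal.commutator_mem {N : Subloop L} (hN : N.IsNormal) (a b : L)
    (h : a ∈ N ∨ b ∈ N) : Loop.commutator a b ∈ N := by
  have self : ∀ x : L, Loop.ldiv x x = 1 := fun x => by
    conv_lhs => arg 2; rw [← mul_one x]
    exact Loop.ldiv_mul_cancel x 1
  have r : ∀ x : L, ∃ n ∈ N, x = x * n := fun x => ⟨1, N.one_mem', (mul_one x).symm⟩
  rcases h with h | h
  · have h1 : ∃ n ∈ N, a = 1 * n := ⟨a, h, (one_mul a).symm⟩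
    obtain ⟨n, hn, e⟩ := hN.ldiv_congr (hN.mul_congr (r b) h1) (hN.mul_congr h1 (r b))
    rw [mul_one, one_mul, self, one_mul] at e
    exact (show Loop.commutator a b = n from e) ▸ hn
  · have h1 : ∃ n ∈ N, b = 1 * n := ⟨b, h, (one_mul b).symm⟩
    obtain ⟨n, hn, e⟩ := hN.ldiv_congr (hN.mul_congr h1 (r a)) (hN.mul_congr (r a) h1)
    rw [mul_one, one_mul, self, one_mul] at e
    exact (show Loop.commutator a b = n from e) ▸ hn

end Subloop

/-- Non-associative words in one letter (together with the empty word), formed with the product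
and the two divisions. -/
inductive LoopWord : Type
  | letter : LoopWord
  | one : LoopWord
  | mul : LoopWord → LoopWord → LoopWord
  | ldiv : LoopWord → LoopWord → LoopWord
  | rdiv : LoopWord → LoopWord → LoopWord

namespace LoopWord

/-- The value `w(x)` of a word at an element of a loop. -/
def eval {L : Type u} [Loop L] (x : L) : LoopWord → L
  | letter => x
  | one => 1
  | mul s t => eval x s * eval x t
  | ldiv s t => Loop.ldiv (eval x s) (eval x t)
  | rdiv s t => eval x s / eval x t

/-- The degree of a word: its image under the homomorphism from the free loop on one generator
to the additive group `ℤ` that sends the generator to `1`. -/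
def degree : LoopWord → ℤ
  | letter => 1
  | one => 0
  | mul s t => degree s + degree t
  | ldiv s t => -degree s + degree t
  | rdiv s t => degree s - degree t

end LoopWord

/-- The isolator `√K` of `K`: the minimal normal subloop containing all `x` such that `w(x) ∈ K`
for some word `w` of non-zero degree. -/
def Subloop.isolator {L : Type u} [Loop L] (K : Subloop L) : Subloop L :=
  Subloop.normalClosure {x | ∃ w : LoopWord, w.degree ≠ 0 ∧ w.eval x ∈ K}

namespace Loop

/-- The commutator-associator subloops: `γ₁ L = L`, and for `n > 1` the subloop `γ_n L` is the
minimal normal subloop containing all `[γ_p L, γ_q L]` with `p + q ≥ n` and all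
`(γ_{p₁} L, …, γ_{p_{l+3}} L)_{α₁, …, α_l}` with `p₁ + … + p_{l+3} ≥ n` and `l ≥ 0`. For the
recursion, the indices `p` are taken to be smaller than `n`; by `gamma_eq` below this is no
restriction. (The value at `0` is irrelevant.) -/
def gamma (L : Type u) [Loop L] (n : ℕ) : Subloop L :=
  if n ≤ 1 then ⊤ else
    Subloop.normalClosure
      ({z | ∃ p q : ℕ, ∃ (_ : 1 ≤ p ∧ p < n) (_ : 1 ≤ q ∧ q < n), n ≤ p + q ∧
          ∃ a ∈ gamma L p, ∃ b ∈ gamma L q, z = commutator a b} ∪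
        {z | ∃ (l : ℕ) (α : DeviationIndex l) (p : Fin (l + 3) → ℕ)
          (_ : ∀ i, 1 ≤ p i ∧ p i < n), n ≤ ∑ i, p i ∧
          ∃ a : Fin (l + 3) → L, (∀ i, a i ∈ gamma L (p i)) ∧ z = deviation l α a})
termination_by n
decreasing_by all_goals grind

theorem gamma_isNormal (L : Type u) [Loop L] (n : ℕ) : (gamma L n).IsNormal := by
  rw [gamma]
  split_ifs
  · constructor <;> intros <;> apply Set.Subset.antisymm
    · rintro _ ⟨n, -, rfl⟩
      exact ⟨_, trivial, rdiv_mul_cancel _ _⟩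
    · rintro _ ⟨n, -, rfl⟩
      exact ⟨_, trivial, mul_ldiv_cancel _ _⟩
    · rintro _ ⟨n, -, rfl⟩
      exact ⟨_, trivial, mul_ldiv_cancel _ _⟩
    · rintro _ ⟨n, -, rfl⟩
      exact ⟨ldiv _ (ldiv _ _), trivial, (congrArg _ (mul_ldiv_cancel _ _)).trans
        (mul_ldiv_cancel _ _)⟩
    · rintro _ ⟨n, -, rfl⟩
      exact ⟨_, trivial, rdiv_mul_cancel _ _⟩
    · rintro _ ⟨n, -, rfl⟩
      exact ⟨(_ / _) / _, trivial, (congrArg (· * _) (rdiv_mul_cancel _ _)).trans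
        (rdiv_mul_cancel _ _)⟩
  · exact Subloop.isNormal_normalClosure _

theorem gamma_one (L : Type u) [Loop L] : gamma L 1 = ⊤ := by
  rw [gamma]; simp

theorem gamma_succ_le (L : Type u) [Loop L] (n : ℕ) : gamma L (n + 1) ≤ gamma L n := by
  by_cases hn : n ≤ 1
  · intro x _
    rw [gamma, if_pos hn]
    trivial
  rw [gamma, if_neg (by omega)]
  refine Subloop.normalClosure_le (gamma_isNormal L n) ?_
  rintro z (⟨p, q, hp, hq, hpq, a, ha, b, hb, rfl⟩ | ⟨l, α, p, hp, hs, a, ha, rfl⟩)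
  · by_cases h1 : p = n
    · subst h1
      exact (gamma_isNormal L p).commutator_mem _ _ (Or.inl ha)
    by_cases h2 : q = n
    · subst h2
      exact (gamma_isNormal L q).commutator_mem _ _ (Or.inr hb)
    rw [gamma, if_neg hn]
    exact Subloop.subset_normalClosure _
      (Or.inl ⟨p, q, by omega, by omega, by omega, a, ha, b, hb, rfl⟩)
  · by_cases h : ∃ i, p i = n
    · obtain ⟨i, hi⟩ := h
      exact (gamma_isNormal L n).deviation_mem _ _ _ i (hi ▸ ha i)
    push Not at h
    rw [gamma, if_neg hn]
    exact Subloop.subset_normalClosure _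
      (Or.inr ⟨l, α, p, fun i => by have := hp i; have := h i; omega, by omega, a, ha, rfl⟩)

theorem gamma_antitone (L : Type u) [Loop L] : Antitone (gamma L) :=
  antitone_nat_of_succ_le (gamma_succ_le L)

/-- The defining property of the commutator-associator subloops, with no upper bound on the
indices `p`. -/
theorem gamma_eq (L : Type u) [Loop L] (n : ℕ) (hn : 1 < n) :
    gamma L n = Subloop.normalClosure
      ({z | ∃ p q : ℕ, 1 ≤ p ∧ 1 ≤ q ∧ n ≤ p + q ∧
          ∃ a ∈ gamma L p, ∃ b ∈ gamma L q, z = commutator a b} ∪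
        {z | ∃ (l : ℕ) (α : DeviationIndex l) (p : Fin (l + 3) → ℕ),
          (∀ i, 1 ≤ p i) ∧ n ≤ ∑ i, p i ∧
          ∃ a : Fin (l + 3) → L, (∀ i, a i ∈ gamma L (p i)) ∧ z = deviation l α a}) := by
  apply le_antisymm
  · rw [gamma, if_neg (by omega)]
    refine Subloop.normalClosure_le (Subloop.isNormal_normalClosure _)
      (Set.Subset.trans ?_ (Subloop.subset_normalClosure _))
    rintro z (⟨p, q, hp, hq, h⟩ | ⟨l, α, p, hp, h⟩)
    · exact Or.inl ⟨p, q, hp.1, hq.1, h⟩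
    · exact Or.inr ⟨l, α, p, fun i => (hp i).1, h⟩
  · refine Subloop.normalClosure_le (gamma_isNormal L n) ?_
    rintro z (⟨p, q, hp, hq, hpq, a, ha, b, hb, rfl⟩ | ⟨l, α, p, hp, hs, a, ha, rfl⟩)
    · by_cases h1 : n ≤ p
      · exact (gamma_isNormal L n).commutator_mem _ _ (Or.inl (gamma_antitone L h1 ha))
      by_cases h2 : n ≤ q
      · exact (gamma_isNormal L n).commutator_mem _ _ (Or.inr (gamma_antitone L h2 hb))
      rw [gamma, if_neg (by omega)]
      exact Subloop.subset_normalClosure _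
        (Or.inl ⟨p, q, by omega, by omega, hpq, a, ha, b, hb, rfl⟩)
    · by_cases h : ∃ i, n ≤ p i
      · obtain ⟨i, hi⟩ := h
        exact (gamma_isNormal L n).deviation_mem _ _ _ i (gamma_antitone L hi (ha i))
      push Not at h
      rw [gamma, if_neg (by omega)]
      exact Subloop.subset_normalClosure _
        (Or.inr ⟨l, α, p, fun i => ⟨hp i, h i⟩, hs, a, ha, rfl⟩)

end Loop

/-- Expressions formed from the indeterminates in `X` by repeatedly applying commutators and
associator deviations; the associator is the deviation of level zero. -/
inductive BracketTerm (X : Type) : Type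
  | var : X → BracketTerm X
  | commutator : BracketTerm X → BracketTerm X → BracketTerm X
  | deviation (l : ℕ) (α : Loop.DeviationIndex l) (t : Fin (l + 3) → BracketTerm X) :
      BracketTerm X

namespace BracketTerm

/-- The number of occurrences of the indeterminate `i` in an expression. -/
def occurrences {X : Type} [DecidableEq X] (i : X) : BracketTerm X → ℕ
  | var j => if j = i then 1 else 0
  | commutator s t => occurrences i s + occurrences i t
  | deviation _ _ t => ∑ j, occurrences i (t j)

/-- A bracket of weight `n` is an expression in `n` indeterminates in which every indeterminate
appears exactly once. -/
def IsBracket {n : ℕ} (t : BracketTerm (Fin n)) : Prop :=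
  ∀ i : Fin n, t.occurrences i = 1

/-- The value of an expression at elements of a loop. -/
def eval {X : Type} {L : Type u} [Loop L] (x : X → L) : BracketTerm X → L
  | var i => x i
  | commutator s t => Loop.commutator (eval x s) (eval x t)
  | deviation l α t => Loop.deviation l α (fun j => eval x (t j))

end BracketTerm

/-- A filtration `L = F₁ ⊇ F₂ ⊇ …` of a loop by normal subloops is an `N`-sequence if every
bracket of weight `n` takes elements `x i ∈ F_{p i}` to an element of `F_{p₁ + … + p_n}`. The
terms of the filtration are indexed by positive integers; the value at `0` is irrelevant. -/
structure Loop.IsNSequence {L : Type u} [Loop L] (F : ℕ → Subloop L) : Prop where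
  normal : ∀ n, 1 ≤ n → (F n).IsNormal
  one_eq : F 1 = ⊤
  succ_le : ∀ n, 1 ≤ n → F (n + 1) ≤ F n
  bracket_mem : ∀ (n : ℕ) (t : BracketTerm (Fin n)), t.IsBracket →
    ∀ p : Fin n → ℕ, (∀ i, 1 ≤ p i) →
    ∀ x : Fin n → L, (∀ i, x i ∈ F (p i)) → t.eval x ∈ F (∑ i, p i)

/-!
Write `R n` for the isolator of `γ_n L`. The argument has two halves.

*Torsion elements modulo `γ_n L` form a normal subloop*, so that `R n` is exactly the set of `x` with
`w(x) ∈ γ_n L` for some word `w` of non-zero degree (`Loop.mem_isolator_gamma_iff`), and `L / R n` is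
torsion-free. To see this, let `T` be the set of torsion elements and consider the descending series
of normal subloops generated by `T` and by brackets having one entry in an earlier term of the series
and the other entries in terms of the commutator-associator series (`Loop.relativeSeries`). Its
factors are central. Brackets are multiplicative in each argument modulo the next term, because the
failure to be so is measured by brackets with one more argument, and multiplicative maps commute with
words (`LoopWord.map_eval`). Hence the torsion elements of the factors, which are abelian groups,
form a series with the same closure properties, and by minimality all factors are torsion. As the
series reaches `γ_n L` after `n` steps, all of its elements are torsion modulo `γ_n L`.

*Brackets respect the weights.* Modulo `R n`, consider a deviation with entries in `R (p i)` and
`n ≤ ∑ p i`. By descending induction on the level it is multiplicative in each argument; replacing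
the arguments one after the other by the values of suitable words, which lie in `γ_(p i) L`, shows
that the deviation is torsion modulo `R n`, and therefore trivial. A commutator has no deviations of
its own, and `x ↦ [x, z]` is multiplicative modulo `R n` only once associators and the commutators
`[[x, z], x']` are known to lie in `R n`. The latter is obtained by descending induction
on a term of the commutator-associator series in which the entries lie.
-/

/-! ### Quotient loops -/

namespace Subloop

variable {L : Type u} [Loop L] {K : Subloop L}

theorem IsNormal.rdiv_congr (hK : K.IsNormal) {x y x' y' : L}
    (hx : ∃ n ∈ K, x' = x * n) (hy : ∃ n ∈ K, y' = y * n) :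
    ∃ n ∈ K, x' / y' = x / y * n := by
  have h1 := hK.mul_congr ⟨1, K.one_mem', (mul_one (x / y)).symm⟩ (hK.symm hy)
  rw [Loop.rdiv_mul_cancel] at h1
  obtain ⟨n, hn, h⟩ := hK.trans h1 hx
  obtain ⟨n1, hn1, h2⟩ := (hK.comm (x / y * y')).subset ⟨n, hn, rfl⟩
  obtain ⟨n2, hn2, h3⟩ := (hK.right (x / y) y').superset ⟨n1, hn1, rfl⟩
  obtain ⟨n3, hn3, h4⟩ := (hK.comm (x / y)).superset ⟨n2, hn2, rfl⟩
  simp only at h2 h3 h4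
  refine ⟨n3, hn3, ?_⟩
  rw [h4, h, ← h2, ← h3, Loop.mul_rdiv_cancel]

/-- Congruence modulo a normal subloop. -/
def IsNormal.setoid (hK : K.IsNormal) : Setoid L where
  r x y := ∃ n ∈ K, y = x * n
  iseqv := ⟨fun x => ⟨1, K.one_mem', (mul_one x).symm⟩, hK.symm, hK.trans⟩

/-- The quotient `L / K` of a loop by a normal subloop. -/
def IsNormal.Quot (hK : K.IsNormal) : Type u := Quotient hK.setoid

/-- The projection `L → L / K`. -/
def IsNormal.proj (hK : K.IsNormal) (x : L) : hK.Quot := Quotient.mk hK.setoid x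

theorem IsNormal.proj_surjective (hK : K.IsNormal) : Function.Surjective hK.proj :=
  Quotient.exists_rep

theorem IsNormal.proj_eq (hK : K.IsNormal) {x y : L} : hK.proj x = hK.proj y ↔ ∃ n ∈ K, y = x * n :=
  Quotient.eq (r := hK.setoid)

instance (hK : K.IsNormal) : Loop hK.Quot where
  one := hK.proj 1
  mul := Quotient.map₂ (· * ·) fun _ _ hx _ _ hy => hK.mul_congr hx hy
  div := Quotient.map₂ (· / ·) fun _ _ hx _ _ hy => hK.rdiv_congr hx hy
  ldiv := Quotient.map₂ Loop.ldiv fun _ _ hx _ _ hy => hK.ldiv_congr hx hy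
  one_mul := by rintro ⟨x⟩; exact congrArg hK.proj (one_mul x)
  mul_one := by rintro ⟨x⟩; exact congrArg hK.proj (mul_one x)
  mul_ldiv_cancel := by rintro ⟨x⟩ ⟨y⟩; exact congrArg hK.proj (Loop.mul_ldiv_cancel x y)
  ldiv_mul_cancel := by rintro ⟨x⟩ ⟨y⟩; exact congrArg hK.proj (Loop.ldiv_mul_cancel x y)
  rdiv_mul_cancel := by rintro ⟨x⟩ ⟨y⟩; exact congrArg hK.proj (Loop.rdiv_mul_cancel x y)
  mul_rdiv_cancel := by rintro ⟨x⟩ ⟨y⟩; exact congrArg hK.proj (Loop.mul_rdiv_cancel x y)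

theorem IsNormal.proj_mul (hK : K.IsNormal) (x y : L) :
    hK.proj (x * y) = hK.proj x * hK.proj y := rfl

theorem IsNormal.proj_ldiv (hK : K.IsNormal) (x y : L) :
    hK.proj (Loop.ldiv x y) = Loop.ldiv (hK.proj x) (hK.proj y) := rfl

theorem IsNormal.proj_rdiv (hK : K.IsNormal) (x y : L) :
    hK.proj (x / y) = hK.proj x / hK.proj y := rfl

theorem IsNormal.proj_commutator (hK : K.IsNormal) (x y : L) :
    hK.proj (Loop.commutator x y) = Loop.commutator (hK.proj x) (hK.proj y) := rfl

theorem IsNormal.proj_associator (hK : K.IsNormal) (x y z : L) :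
    hK.proj (Loop.associator x y z) = Loop.associator (hK.proj x) (hK.proj y) (hK.proj z) := rfl

theorem IsNormal.proj_eq_one (hK : K.IsNormal) {x : L} : hK.proj x = 1 ↔ x ∈ K := by
  rw [eq_comm]
  refine (hK.proj_eq (x := 1)).trans ?_
  simp

end Subloop

/-! ### Identities in loops -/

namespace Loop

variable {L : Type u} [Loop L]

theorem ldiv_eq_iff {a b c : L} : ldiv a b = c ↔ b = a * c :=
  ⟨fun h => by rw [← h, mul_ldiv_cancel], fun h => by rw [h, ldiv_mul_cancel]⟩

theorem rdiv_eq_iff {a b c : L} : b / a = c ↔ b = c * a :=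
  ⟨fun h => by rw [← h, rdiv_mul_cancel], fun h => by rw [h, mul_rdiv_cancel]⟩

theorem commutator_eq_one_iff {a b : L} : commutator a b = 1 ↔ a * b = b * a := by
  rw [commutator, ldiv_eq_iff, mul_one]

theorem associator_eq_one_iff {a b c : L} : associator a b c = 1 ↔ a * b * c = a * (b * c) := by
  rw [associator, ldiv_eq_iff, mul_one]

theorem mul_eq_mul_commutator (a b : L) : a * b = b * a * commutator a b :=
  (mul_ldiv_cancel _ _).symm

end Loop

namespace Subloop

variable {L : Type u} [Loop L] {K : Subloop L}

theorem IsNormal.commutator_mem_iff (hK : K.IsNormal) {a b : L} :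
    Loop.commutator a b ∈ K ↔ hK.proj a * hK.proj b = hK.proj b * hK.proj a := by
  rw [← hK.proj_eq_one, hK.proj_commutator, Loop.commutator_eq_one_iff]

theorem IsNormal.associator_mem_iff (hK : K.IsNormal) {a b c : L} :
    Loop.associator a b c ∈ K ↔
      hK.proj a * hK.proj b * hK.proj c = hK.proj a * (hK.proj b * hK.proj c) := by
  rw [← hK.proj_eq_one, hK.proj_associator, Loop.associator_eq_one_iff]

theorem IsNormal.commutator_mem_comm (hK : K.IsNormal) {a b : L} :
    Loop.commutator a b ∈ K ↔ Loop.commutator b a ∈ K := by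
  rw [hK.commutator_mem_iff, hK.commutator_mem_iff, eq_comm]

end Subloop

/-! ### Words in one letter -/

namespace LoopWord

/-- Words commute with maps that are multiplicative on a subloop: multiplicativity implies
compatibility with both divisions. -/
theorem map_eval {L Q : Type*} [Loop L] [Loop Q] (P : Subloop L) (f : L → Q)
    (hf : ∀ x ∈ P, ∀ y ∈ P, f (x * y) = f x * f y) {x : L} (hx : x ∈ P) (w : LoopWord) :
    w.eval x ∈ P ∧ f (w.eval x) = w.eval (f x) := by
  induction w with
  | letter => exact ⟨hx, rfl⟩
  | one =>
    refine ⟨P.one_mem', ?_⟩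
    have h := hf 1 P.one_mem' 1 P.one_mem'
    rw [mul_one] at h
    exact Subloop.mul_left_inj' (h.symm.trans (mul_one _).symm)
  | mul s t hs ht => exact ⟨P.mul_mem' hs.1 ht.1, by simp only [eval, hf _ hs.1 _ ht.1, hs.2, ht.2]⟩
  | ldiv s t hs ht =>
    have h := P.ldiv_mem' hs.1 ht.1
    refine ⟨h, ?_⟩
    rw [eval, eval, ← hs.2, ← ht.2, eq_comm, Loop.ldiv_eq_iff, ← hf _ hs.1 _ h,
      Loop.mul_ldiv_cancel]
  | rdiv s t hs ht =>
    have h := P.rdiv_mem' hs.1 ht.1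
    refine ⟨h, ?_⟩
    rw [eval, eval, ← hs.2, ← ht.2, eq_comm, Loop.rdiv_eq_iff, ← hf _ h _ ht.1,
      Loop.rdiv_mul_cancel]

theorem proj_eval {L : Type u} [Loop L] {K : Subloop L} (hK : K.IsNormal) (w : LoopWord) (x : L) :
    hK.proj (w.eval x) = w.eval (hK.proj x) :=
  (map_eval ⊤ hK.proj (fun x _ y _ => hK.proj_mul x y) trivial w).2

theorem eval_mem {L : Type u} [Loop L] (K : Subloop L) {x : L} (hx : x ∈ K) (w : LoopWord) :
    w.eval x ∈ K :=
  (map_eval K id (fun _ _ _ _ => rfl) hx w).1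

/-- The word `w(v)`. -/
def comp (w v : LoopWord) : LoopWord :=
  match w with
  | letter => v
  | one => one
  | mul s t => mul (comp s v) (comp t v)
  | ldiv s t => ldiv (comp s v) (comp t v)
  | rdiv s t => rdiv (comp s v) (comp t v)

theorem eval_comp {L : Type u} [Loop L] (x : L) (w v : LoopWord) :
    (w.comp v).eval x = w.eval (v.eval x) := by
  induction w <;> simp_all [comp, eval]

theorem degree_comp (w v : LoopWord) : (w.comp v).degree = w.degree * v.degree := by
  induction w with
  | letter => simp [comp, degree]
  | one => simp [comp, degree]
  | mul s t hs ht => simp only [comp, degree, hs, ht]; ring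
  | ldiv s t hs ht => simp only [comp, degree, hs, ht]; ring
  | rdiv s t hs ht => simp only [comp, degree, hs, ht]; ring

end LoopWord

/-! ### The centre of a loop -/

namespace Loop

variable {L : Type u} [Loop L]

theorem mem_center_iff {z : L} : z ∈ Set.center L ↔
    (∀ a, z * a = a * z) ∧ (∀ b c, z * (b * c) = z * b * c) ∧ ∀ a b, a * b * z = a * (b * z) :=
  ⟨fun h => ⟨h.comm, h.left_assoc, h.right_assoc⟩, fun h => ⟨h.1, h.2.1, h.2.2⟩⟩

/-- The right inverse of a central element is central. -/
theorem ldiv_one_mem_center {z : L} (hz : z ∈ Set.center L) : ldiv z 1 ∈ Set.center L := by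
  obtain ⟨h1, h2, h3⟩ := mem_center_iff.1 hz
  have e : z * ldiv z 1 = 1 := mul_ldiv_cancel z 1
  have c : ∀ a, ldiv z 1 * a = a * ldiv z 1 := fun a => Subloop.mul_left_inj' (a := z) <| by
    rw [h2, h2, h1 a, hz.mid_assoc, e, one_mul, mul_one]
  refine mem_center_iff.2 ⟨c, fun a b => Subloop.mul_left_inj' (a := z) ?_,
    fun a b => Subloop.mul_left_inj' (a := z) ?_⟩
  · rw [h2, h2, h2, e, one_mul, one_mul]
  · rw [← c (a * b), ← c b, h2 _ (a * b), e, one_mul, h2 a, h1 a, hz.mid_assoc, h2 (ldiv z 1) b, e,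
      one_mul]

/-- The centre of a loop, an abelian group. -/
def Center (L : Type u) [Loop L] : Type u := Set.center L

instance : CommGroup (Center L) where
  mul a b := ⟨a.1 * b.1, Set.mul_mem_center a.2 b.2⟩
  one := ⟨1, Set.one_mem_center⟩
  inv a := ⟨ldiv a.1 1, ldiv_one_mem_center a.2⟩
  mul_assoc a b c := Subtype.ext ((mem_center_iff.1 a.2).2.1 b.1 c.1).symm
  one_mul a := Subtype.ext (one_mul a.1)
  mul_one a := Subtype.ext (mul_one a.1)
  mul_comm a b := Subtype.ext ((mem_center_iff.1 a.2).1 b.1)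
  inv_mul_cancel a := Subtype.ext <|
    ((mem_center_iff.1 a.2).1 _).symm.trans (mul_ldiv_cancel a.1 1)

/-- The value of a word at a central element only depends on the degree of the word. -/
theorem eval_center (z : Center L) (w : LoopWord) : w.eval z.1 = (z ^ w.degree).1 := by
  induction w with
  | letter => rw [LoopWord.degree, zpow_one]; rfl
  | one => rw [LoopWord.degree, zpow_zero]; rfl
  | mul s t hs ht => rw [LoopWord.degree, zpow_add, LoopWord.eval, hs, ht]; rfl
  | ldiv s t hs ht =>
    rw [LoopWord.degree, LoopWord.eval, hs, ht, ldiv_eq_iff]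
    exact congrArg Subtype.val
      (show z ^ t.degree = z ^ s.degree * z ^ (-s.degree + t.degree) by rw [← zpow_add]; simp)
  | rdiv s t hs ht =>
    rw [LoopWord.degree, LoopWord.eval, hs, ht, rdiv_eq_iff]
    exact congrArg Subtype.val
      (show z ^ s.degree = z ^ (s.degree - t.degree) * z ^ t.degree by rw [← zpow_add]; simp)

end Loop

/-! ### Multiplicativity of brackets in one argument -/

namespace Loop

variable {L : Type u} [Loop L]

theorem contract_insertNth {M : Type u} {n : ℕ} (a : Fin (n + 1) → M) (i : Fin (n + 1))
    (x y z : M) :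
    contract (i.succ.insertNth (α := fun _ => M) y (Function.update a i x)) i z =
      Function.update a i z := by
  funext j
  unfold contract
  rcases lt_trichotomy j i with h | rfl | h
  · have e : i.succ.succAbove j = j.castSucc :=
      Fin.succAbove_of_castSucc_lt _ _ ((Fin.castSucc_lt_succ_iff).2 h.le)
    rw [if_pos h, ← e, Fin.insertNth_apply_succAbove, Function.update_of_ne h.ne,
      Function.update_of_ne h.ne]
  · simp
  · have e : i.succ.succAbove j = j.succ :=
      Fin.succAbove_of_lt_succ _ _ (Fin.succ_lt_succ_iff.2 h)
    rw [if_neg h.not_gt, if_neg h.ne', ← e, Fin.insertNth_apply_succAbove,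
      Function.update_of_ne h.ne', Function.update_of_ne h.ne']

/-- The failure of a deviation to be multiplicative in its `i`th argument is a deviation of the
next level. -/
theorem exists_deviation_insertNth (l : ℕ) (α : DeviationIndex l) (a : Fin (l + 3) → L)
    (i : Fin (l + 3)) (x y : L) :
    ∃ β : DeviationIndex (l + 1),
      deviation (l + 1) β (i.succ.insertNth (α := fun _ => L) y (Function.update a i x)) =
        ldiv (deviation l α (Function.update a i x) * deviation l α (Function.update a i y))
          (deviation l α (Function.update a i (x * y))) := by
  let β : DeviationIndex (l + 1) :=
    Fin.snoc (α := fun j : Fin (l + 1) => Fin ((j : ℕ) + 3)) α i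
  have hlast : β (Fin.last l) = i :=
    Fin.snoc_last (α := fun j : Fin (l + 1) => Fin ((j : ℕ) + 3)) _ _
  have hinit : (fun j : Fin l => β j.castSucc) = α := funext fun j =>
    Fin.snoc_castSucc (α := fun j : Fin (l + 1) => Fin ((j : ℕ) + 3)) _ _ _
  refine ⟨β, ?_⟩
  have e : i.succ.insertNth (α := fun _ => L) y (Function.update a i x) i.castSucc = x := by
    rw [← Fin.succAbove_of_castSucc_lt i.succ i Fin.castSucc_lt_succ,
      Fin.insertNth_apply_succAbove, Function.update_self]
  simp only [deviation, hlast]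
  rw [hinit, e, Fin.insertNth_apply_same, contract_insertNth, contract_insertNth,
    contract_insertNth]

end Loop

namespace Subloop

open Loop

variable {L : Type u} [Loop L] {K : Subloop L}

theorem IsNormal.proj_deviation_mul (hK : K.IsNormal) (l : ℕ) (α : DeviationIndex l)
    (a : Fin (l + 3) → L) (i : Fin (l + 3)) (x y : L)
    (h : ∀ β : DeviationIndex (l + 1),
      deviation (l + 1) β (i.succ.insertNth (α := fun _ => L) y (Function.update a i x)) ∈ K) :
    hK.proj (deviation l α (Function.update a i (x * y))) =
      hK.proj (deviation l α (Function.update a i x)) *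
        hK.proj (deviation l α (Function.update a i y)) := by
  obtain ⟨β, hβ⟩ := exists_deviation_insertNth l α a i x y
  have := h β
  rwa [hβ, ← hK.proj_eq_one, hK.proj_ldiv, ldiv_eq_iff, mul_one, hK.proj_mul] at this

/-- If all associators with an entry in `X` and another one in `Z` vanish modulo `K`, then
`x ↦ [x, z]` is multiplicative modulo `K` on elements `x, x' ∈ X` for which `[[x, z], x'] ∈ K`. -/
theorem IsNormal.proj_commutator_mul (hK : K.IsNormal) {X Z : Subloop L} (hX : X.IsNormal)
    (hZ : Z.IsNormal)
    (h : ∀ (a : Fin 3 → L) (i j : Fin 3), i ≠ j → a i ∈ X → a j ∈ Z →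
      associator (a 0) (a 1) (a 2) ∈ K)
    {x y z : L} (hx : x ∈ X) (hy : y ∈ X) (hz : z ∈ Z)
    (hc : Loop.commutator (Loop.commutator x z) y ∈ K) :
    hK.proj (Loop.commutator (x * y) z) =
      hK.proj (Loop.commutator x z) * hK.proj (Loop.commutator y z) := by
  have A : ∀ (a : Fin 3 → L) (i j : Fin 3), i ≠ j → a i ∈ X → a j ∈ Z →
      hK.proj (a 0) * hK.proj (a 1) * hK.proj (a 2) =
        hK.proj (a 0) * (hK.proj (a 1) * hK.proj (a 2)) := fun a i j hij hi hj =>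
    hK.associator_mem_iff.1 (h a i j hij hi hj)
  have cX := hX.commutator_mem x z (Or.inl hx)
  have cZ := hZ.commutator_mem x z (Or.inr hz)
  have dZ := hZ.commutator_mem y z (Or.inr hz)
  have a1 := A ![x, y, z] 0 2 (by decide) hx hz
  have a2 := A ![x, z * y, Loop.commutator y z] 0 2 (by decide) hx dZ
  have a3 := A ![x, z, y] 0 1 (by decide) hx hz
  have a4 := A ![z * x, Loop.commutator x z, y] 2 1 (by decide) hy cZ
  have a5 := A ![z * x, y, Loop.commutator x z] 1 2 (by decide) hy cZ
  have a6 := A ![z, x, y] 1 0 (by decide) hx hz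
  have a7 := A ![z * (x * y), Loop.commutator x z, Loop.commutator y z] 1 2 (by decide) cX dZ
  have e1 := congrArg hK.proj (mul_eq_mul_commutator x z)
  have e2 := congrArg hK.proj (mul_eq_mul_commutator y z)
  have e3 := hK.commutator_mem_iff.1 hc
  simp only [Matrix.cons_val, hK.proj_mul] at a1 a2 a3 a4 a5 a6 a7 e1 e2
  rw [hK.proj_commutator (x * y), Loop.commutator, ldiv_eq_iff, hK.proj_mul, a1, e2, ← a2, ← a3,
    e1, a4, e3, ← a5, a6, a7]

/-- A subloop that is central modulo a normal subloop `K` contained in it is normal. -/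
theorem IsNormal.of_central (hK : K.IsNormal) {G : Subloop L} (hG : K ≤ G)
    (hc : ∀ g ∈ G, hK.proj g ∈ Set.center hK.Quot) : G.IsNormal := by
  have key : ∀ g ∈ G, ∀ h, hK.proj g = hK.proj h → h ∈ G := by
    intro g hg h e
    obtain ⟨n, hn, rfl⟩ := hK.proj_eq.1 e
    exact G.mul_mem' hg (hG hn)
  have cc := fun g hg => mem_center_iff.1 (hc g hg)
  constructor
  · intro x
    apply Set.Subset.antisymm
    · rintro _ ⟨n, hn, rfl⟩
      refine ⟨x * n / x, key n hn _ ?_, rdiv_mul_cancel _ _⟩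
      rw [hK.proj_rdiv, hK.proj_mul, eq_comm, rdiv_eq_iff, (cc n hn).1]
    · rintro _ ⟨n, hn, rfl⟩
      refine ⟨ldiv x (n * x), key n hn _ ?_, mul_ldiv_cancel _ _⟩
      rw [hK.proj_ldiv, hK.proj_mul, eq_comm, ldiv_eq_iff, (cc n hn).1]
  · intro x y
    apply Set.Subset.antisymm
    · rintro _ ⟨n, hn, rfl⟩
      refine ⟨ldiv (x * y) (x * (y * n)), key n hn _ ?_, mul_ldiv_cancel _ _⟩
      rw [hK.proj_ldiv, eq_comm, ldiv_eq_iff]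
      simp only [hK.proj_mul, (cc n hn).2.2]
    · rintro _ ⟨n, hn, rfl⟩
      refine ⟨ldiv y (ldiv x (x * y * n)), key n hn _ ?_, by simp only [mul_ldiv_cancel]⟩
      rw [hK.proj_ldiv, hK.proj_ldiv, eq_comm, ldiv_eq_iff, ldiv_eq_iff]
      simp only [hK.proj_mul, (cc n hn).2.2]
  · intro x y
    apply Set.Subset.antisymm
    · rintro _ ⟨n, hn, rfl⟩
      refine ⟨n * x * y / (x * y), key n hn _ ?_, rdiv_mul_cancel _ _⟩
      rw [hK.proj_rdiv, eq_comm, rdiv_eq_iff]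
      simp only [hK.proj_mul, (cc n hn).2.1]
    · rintro _ ⟨n, hn, rfl⟩
      refine ⟨n * (x * y) / y / x, key n hn _ ?_, by simp only [rdiv_mul_cancel]⟩
      rw [hK.proj_rdiv, hK.proj_rdiv, eq_comm, rdiv_eq_iff, rdiv_eq_iff]
      simp only [hK.proj_mul, (cc n hn).2.1]

end Subloop

/-! ### Torsion elements modulo a term of the commutator-associator series -/

namespace Loop

variable {L : Type u} [Loop L]

theorem commutator_mem_gamma {n p q : ℕ} (hp : 1 ≤ p) (hq : 1 ≤ q) (h : n ≤ p + q) {a b : L}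
    (ha : a ∈ gamma L p) (hb : b ∈ gamma L q) : commutator a b ∈ gamma L n := by
  by_cases hn : 1 < n
  · rw [gamma_eq L n hn]
    exact Subloop.subset_normalClosure _ (Or.inl ⟨p, q, hp, hq, h, a, ha, b, hb, rfl⟩)
  · rw [gamma, if_pos (by omega)]
    trivial

theorem deviation_mem_gamma {n l : ℕ} (α : DeviationIndex l) {p : Fin (l + 3) → ℕ}
    (hp : ∀ i, 1 ≤ p i) (h : n ≤ ∑ i, p i) {a : Fin (l + 3) → L}
    (ha : ∀ i, a i ∈ gamma L (p i)) : deviation l α a ∈ gamma L n := by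
  by_cases hn : 1 < n
  · rw [gamma_eq L n hn]
    exact Subloop.subset_normalClosure _ (Or.inr ⟨l, α, p, hp, h, a, ha, rfl⟩)
  · rw [gamma, if_pos (by omega)]
    trivial

theorem mem_gamma_one (x : L) : x ∈ gamma L 1 := by
  rw [gamma_one]
  trivial

/-- A descending series of normal subloops containing `γ_n L`, the first of which contains `T`,
such that a commutator or a deviation with one entry in `F p` and the other entries in
terms of the commutator-associator series lies in the term of `F` whose index is `p` plus
the weights of the other entries. -/
structure IsRelativeSeries (n : ℕ) (T : Set L) (F : ℕ → Subloop L) : Prop where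
  normal : ∀ k, (F k).IsNormal
  succ_le : ∀ k, F (k + 1) ≤ F k
  gamma_le : ∀ k, gamma L n ≤ F k
  subset : T ⊆ F 0
  commutator_mem : ∀ p q : ℕ, 1 ≤ q → ∀ a ∈ F p, ∀ b ∈ gamma L q, commutator a b ∈ F (p + q)
  deviation_mem : ∀ (l : ℕ) (α : DeviationIndex l) (p : Fin (l + 3) → ℕ) (i : Fin (l + 3))
    (a : Fin (l + 3) → L), a i ∈ F (p i) → (∀ j, j ≠ i → 1 ≤ p j ∧ a j ∈ gamma L (p j)) →
    deviation l α a ∈ F (∑ j, p j)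

/-- The least relative series. -/
def relativeSeries (n : ℕ) (T : Set L) (k : ℕ) : Subloop L :=
  Subloop.normalClosure {x | ∀ F, IsRelativeSeries n T F → x ∈ F k}

theorem IsRelativeSeries.relativeSeries_le {n : ℕ} {T : Set L} {F : ℕ → Subloop L}
    (hF : IsRelativeSeries n T F) (k : ℕ) : relativeSeries n T k ≤ F k :=
  Subloop.normalClosure_le (hF.normal k) fun _ hx => hx F hF

theorem isRelativeSeries_relativeSeries (n : ℕ) (T : Set L) :
    IsRelativeSeries n T (relativeSeries n T) where
  normal _ := Subloop.isNormal_normalClosure _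
  succ_le _ _ hx := Subloop.subset_normalClosure _ fun _ hF =>
    hF.succ_le _ (hF.relativeSeries_le _ hx)
  gamma_le _ _ hx := Subloop.subset_normalClosure _ fun _ hF => hF.gamma_le _ hx
  subset _ hx := Subloop.subset_normalClosure _ fun _ hF => hF.subset hx
  commutator_mem p q hq a ha b hb := Subloop.subset_normalClosure _ fun _ hF =>
    hF.commutator_mem p q hq a (hF.relativeSeries_le _ ha) b hb
  deviation_mem l α p i a hi hj := Subloop.subset_normalClosure _ fun _ hF =>
    hF.deviation_mem l α p i a (hF.relativeSeries_le _ hi) hj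

/-- The terms of a relative series are indexed from `0`, whereas the weights in `γ` start at `1`;
cutting off at `n` gives the series that bounds the least one from above. -/
theorem isRelativeSeries_gamma {n : ℕ} (hn : 1 ≤ n) (T : Set L) :
    IsRelativeSeries n T (fun k => gamma L (min (k + 1) n)) where
  normal _ := gamma_isNormal L _
  succ_le _ := gamma_antitone L (by omega)
  gamma_le _ := gamma_antitone L (by omega)
  subset x _ := by
    rw [zero_add, min_eq_left hn]
    exact mem_gamma_one x
  commutator_mem p q hq a ha b hb :=
    commutator_mem_gamma (p := min (p + 1) n) (by omega) hq (by omega) ha hb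
  deviation_mem l α p i a hi hj := by
    refine deviation_mem_gamma α (p := Function.update p i (min (p i + 1) n)) (fun j => ?_) ?_
      fun j => ?_
    · by_cases h : j = i
      · subst h; simp; omega
      · simpa [h] using (hj j h).1
    · rw [Finset.sum_update_of_mem (Finset.mem_univ i)]
      have := Finset.sum_eq_add_sum_sdiff_singleton_of_mem (Finset.mem_univ i) p
      omega
    · by_cases h : j = i
      · subst h; simpa using hi
      · simpa [h] using (hj j h).2

namespace IsRelativeSeries

variable {n : ℕ} {T : Set L} {F : ℕ → Subloop L}

theorem associator_mem (hF : IsRelativeSeries n T F) (p : Fin 3 → ℕ) (i : Fin 3)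
    (a : Fin 3 → L) (hi : a i ∈ F (p i)) (hj : ∀ j, j ≠ i → 1 ≤ p j ∧ a j ∈ gamma L (p j)) :
    associator (a 0) (a 1) (a 2) ∈ F (p 0 + p 1 + p 2) := by
  have := hF.deviation_mem 0 finZeroElim p i a hi hj
  rwa [Fin.sum_univ_three] at this

theorem antitone (hF : IsRelativeSeries n T F) : Antitone F := antitone_nat_of_succ_le hF.succ_le

/-- Every factor of a relative series is central. -/
theorem proj_mem_center (hF : IsRelativeSeries n T F) {k : ℕ} {x : L} (hx : x ∈ F k) :
    (hF.normal (k + 1)).proj x ∈ Set.center (hF.normal (k + 1)).Quot := by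
  have hK := hF.normal (k + 1)
  refine mem_center_iff.2 ⟨fun a => ?_, fun b c => ?_, fun a b => ?_⟩
  · obtain ⟨a, rfl⟩ := hK.proj_surjective a
    exact hK.commutator_mem_iff.1
      (hF.commutator_mem k 1 le_rfl x hx a (mem_gamma_one a))
  · obtain ⟨b, rfl⟩ := hK.proj_surjective b
    obtain ⟨c, rfl⟩ := hK.proj_surjective c
    refine (hK.associator_mem_iff.1 (hF.succ_le _ ?_)).symm
    refine hF.associator_mem ![k, 1, 1] 0 ![x, b, c] hx fun j hj => ?_
    fin_cases j
    · exact absurd rfl hj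
    · exact ⟨le_rfl, mem_gamma_one _⟩
    · exact ⟨le_rfl, mem_gamma_one _⟩
  · obtain ⟨a, rfl⟩ := hK.proj_surjective a
    obtain ⟨b, rfl⟩ := hK.proj_surjective b
    refine hK.associator_mem_iff.1 (hF.succ_le _ ?_)
    have h := hF.associator_mem ![1, 1, k] 2 ![a, b, x] hx fun j hj => ?_
    · exact hF.antitone (by simp; omega) h
    fin_cases j
    · exact ⟨le_rfl, mem_gamma_one _⟩
    · exact ⟨le_rfl, mem_gamma_one _⟩
    · exact absurd rfl hj

/-- The image of an element of `F k` in the centre of `L / F (k + 1)`. -/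
def toCenter (hF : IsRelativeSeries n T F) {k : ℕ} {x : L} (hx : x ∈ F k) :
    Center (hF.normal (k + 1)).Quot :=
  ⟨(hF.normal (k + 1)).proj x, hF.proj_mem_center hx⟩

theorem eval_mem_iff (hF : IsRelativeSeries n T F) {k : ℕ} {x : L} (hx : x ∈ F k)
    (w : LoopWord) : w.eval x ∈ F (k + 1) ↔ hF.toCenter hx ^ w.degree = 1 := by
  have hK := hF.normal (k + 1)
  rw [← hK.proj_eq_one, w.proj_eval hK]
  exact (Eq.congr_left (eval_center (hF.toCenter hx) w)).trans
    ⟨fun h => Subtype.ext h, fun h => congrArg Subtype.val h⟩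

/-- Elements of `F k` that depend on torsion elements in the abelian group `F k / F (k + 1)` are
torsion: the composition of two words that witness torsion kills both elements. -/
theorem exists_eval_mem (hF : IsRelativeSeries n T F) {k : ℕ} {x y z : L} (hx : x ∈ F k)
    (hy : y ∈ F k) (hz : z ∈ F k) (r s : ℤ)
    (e : hF.toCenter hz = hF.toCenter hx ^ r * hF.toCenter hy ^ s)
    (ex : ∃ w : LoopWord, w.degree ≠ 0 ∧ w.eval x ∈ F (k + 1))
    (ey : ∃ w : LoopWord, w.degree ≠ 0 ∧ w.eval y ∈ F (k + 1)) :
    ∃ w : LoopWord, w.degree ≠ 0 ∧ w.eval z ∈ F (k + 1) := by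
  obtain ⟨v, hv, ev⟩ := ex
  obtain ⟨w, hw, ew⟩ := ey
  rw [hF.eval_mem_iff hx] at ev
  rw [hF.eval_mem_iff hy] at ew
  refine ⟨v.comp w, ?_, ?_⟩
  · rw [LoopWord.degree_comp]
    exact mul_ne_zero hv hw
  · rw [hF.eval_mem_iff hz, e, LoopWord.degree_comp, mul_zpow, ← zpow_mul, ← zpow_mul,
      show r * (v.degree * w.degree) = v.degree * (r * w.degree) by ring,
      show s * (v.degree * w.degree) = w.degree * (s * v.degree) by ring,
      zpow_mul _ v.degree, ev, zpow_mul _ w.degree, ew, one_zpow, one_zpow, one_mul]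

/-- The elements of `F k` that are torsion modulo `F (k + 1)`. They form a subloop because
`F k / F (k + 1)` is an abelian group. -/
def torsion (hF : IsRelativeSeries n T F) (k : ℕ) : Subloop L where
  carrier := {x | x ∈ F k ∧ ∃ w : LoopWord, w.degree ≠ 0 ∧ w.eval x ∈ F (k + 1)}
  one_mem' := ⟨(F k).one_mem', .letter, one_ne_zero, (F (k + 1)).one_mem'⟩
  mul_mem' := fun {a b} ha hb => by
    have h := (F k).mul_mem' ha.1 hb.1
    refine ⟨h, hF.exists_eval_mem ha.1 hb.1 h 1 1 ?_ ha.2 hb.2⟩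
    rw [zpow_one, zpow_one]
    rfl
  ldiv_mem' := fun {a b} ha hb => by
    have h := (F k).ldiv_mem' ha.1 hb.1
    refine ⟨h, hF.exists_eval_mem ha.1 hb.1 h (-1) 1 ?_ ha.2 hb.2⟩
    rw [zpow_neg_one, zpow_one, eq_inv_mul_iff_mul_eq]
    exact Subtype.ext (congrArg (hF.normal (k + 1)).proj (mul_ldiv_cancel a b))
  rdiv_mem' := fun {a b} ha hb => by
    have h := (F k).rdiv_mem' ha.1 hb.1
    refine ⟨h, hF.exists_eval_mem ha.1 hb.1 h 1 (-1) ?_ ha.2 hb.2⟩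
    rw [zpow_neg_one, zpow_one, eq_mul_inv_iff_mul_eq]
    exact Subtype.ext (congrArg (hF.normal (k + 1)).proj (rdiv_mul_cancel b a))

theorem le_torsion (hF : IsRelativeSeries n T F) (k : ℕ) : F (k + 1) ≤ hF.torsion k :=
  fun _ hx => ⟨hF.succ_le k hx, .letter, one_ne_zero, hx⟩

/-- If the entry from the relative series is torsion, then so is the commutator, since
`x ↦ [x, b]` is multiplicative modulo the next term. -/
theorem commutator_mem_torsion (hF : IsRelativeSeries n T F) {p q : ℕ} (hq : 1 ≤ q) {a b : L}
    (ha : a ∈ hF.torsion p) (hb : b ∈ gamma L q) : commutator a b ∈ hF.torsion (p + q) := by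
  obtain ⟨ha, w, hw, hwa⟩ := ha
  refine ⟨hF.commutator_mem p q hq a ha b hb, w, hw, ?_⟩
  have hK := hF.normal (p + q + 1)
  have hom : ∀ x ∈ F p, ∀ y ∈ F p, hK.proj (commutator (x * y) b) =
      hK.proj (commutator x b) * hK.proj (commutator y b) := by
    intro x hx y hy
    refine hK.proj_commutator_mul (hF.normal p) (gamma_isNormal L q) (fun a i j hij hi hj => ?_)
      hx hy hb ?_
    · have h := hF.associator_mem (Function.update (Function.update 1 j q) i p) i a
        (by simpa using hi) fun m hm => ?_
      · refine hF.antitone (le_of_eq ?_) h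
        clear h hi hj
        fin_cases i <;> fin_cases j <;> simp [Function.update] at hij ⊢ <;> omega
      · rw [Function.update_of_ne hm]
        by_cases h : m = j
        · subst h; simpa using ⟨hq, hj⟩
        · rw [Function.update_of_ne h]
          exact ⟨le_rfl, mem_gamma_one _⟩
    · exact hF.commutator_mem (p + q) 1 le_rfl _ (hF.commutator_mem p q hq x hx b hb) y
        (mem_gamma_one y)
  have h := (w.map_eval (F p) (fun x => hK.proj (commutator x b)) hom ha).2
  rw [← hK.proj_eq_one, w.proj_eval hK, ← h, hK.proj_eq_one]
  exact hF.antitone (by omega) (hF.commutator_mem (p + 1) q hq _ hwa b hb)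

/-- If the entry from the relative series is torsion, then so is the deviation, since
deviations are multiplicative in each argument modulo the next term. -/
theorem deviation_mem_torsion (hF : IsRelativeSeries n T F) (l : ℕ) (α : DeviationIndex l)
    (p : Fin (l + 3) → ℕ) (i : Fin (l + 3)) (a : Fin (l + 3) → L) (hi : a i ∈ hF.torsion (p i))
    (hj : ∀ j, j ≠ i → 1 ≤ p j ∧ a j ∈ gamma L (p j)) :
    deviation l α a ∈ hF.torsion (∑ j, p j) := by
  obtain ⟨hi, w, hw, hwa⟩ := hi
  refine ⟨hF.deviation_mem l α p i a hi hj, w, hw, ?_⟩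
  have hK := hF.normal (∑ j, p j + 1)
  have hom : ∀ x ∈ F (p i), ∀ y ∈ F (p i),
      hK.proj (deviation l α (Function.update a i (x * y))) =
      hK.proj (deviation l α (Function.update a i x)) *
        hK.proj (deviation l α (Function.update a i y)) := by
    intro x hx y hy
    refine hK.proj_deviation_mul l α a i x y fun β => ?_
    -- The inserted entry `y` is only used as an element of `γ₁ L`, which adds the weight `1`.
    have h := hF.deviation_mem (l + 1) β (i.succ.insertNth (α := fun _ => ℕ) 1 p)
      (i.succ.succAbove i) (i.succ.insertNth (α := fun _ => L) y (Function.update a i x))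
      (by simpa only [Fin.insertNth_apply_succAbove, Function.update_self] using hx) ?_
    · refine hF.antitone (le_of_eq ?_) h
      rw [Fin.sum_univ_succAbove _ i.succ]
      simp only [Fin.insertNth_apply_succAbove, Fin.insertNth_apply_same]
      omega
    · rw [Fin.forall_iff_succAbove i.succ]
      refine ⟨fun _ => ?_, fun j hji => ?_⟩
      · simp only [Fin.insertNth_apply_same]
        exact ⟨le_rfl, mem_gamma_one _⟩
      · have hji : j ≠ i := fun h => hji (by rw [h])
        simpa only [Fin.insertNth_apply_succAbove, Function.update_of_ne hji] using hj j hji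
  have h := (w.map_eval (F (p i))
    (fun x => hK.proj (deviation l α (Function.update a i x))) hom hi).2
  rw [Function.update_eq_self] at h
  rw [← hK.proj_eq_one, w.proj_eval hK, ← h, hK.proj_eq_one]
  -- Since `w (a i)` lies in `F (p i + 1)`, replacing `a i` by it raises the weight by one.
  have h' := hF.deviation_mem l α (Function.update p i (p i + 1)) i
    (Function.update a i (w.eval (a i))) (by simpa using hwa) fun j h => by
      simpa [h] using hj j h
  refine hF.antitone (le_of_eq ?_) h'
  rw [Finset.sum_update_of_mem (Finset.mem_univ i)]
  have := Finset.sum_eq_add_sum_sdiff_singleton_of_mem (Finset.mem_univ i) p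
  omega

/-- If all elements of `T` are torsion modulo `γ_n L`, the torsion elements in the factors of a
relative series form a relative series again. -/
theorem isRelativeSeries_torsion (hF : IsRelativeSeries n T F)
    (hT : ∀ x ∈ T, ∃ w : LoopWord, w.degree ≠ 0 ∧ w.eval x ∈ gamma L n) :
    IsRelativeSeries n T hF.torsion where
  normal k := (hF.normal (k + 1)).of_central (hF.le_torsion k) fun _ hg =>
    hF.proj_mem_center hg.1
  succ_le k _ hx := hF.le_torsion k hx.1
  gamma_le k _ hx := hF.le_torsion k (hF.gamma_le _ hx)
  subset x hx := by
    obtain ⟨w, hw, h⟩ := hT x hx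
    exact ⟨hF.subset hx, w, hw, hF.gamma_le _ h⟩
  commutator_mem _ _ hq _ ha _ hb := hF.commutator_mem_torsion hq ha hb
  deviation_mem := hF.deviation_mem_torsion

end IsRelativeSeries

/-- The isolator of `γ_n L` consists of the elements that are torsion modulo `γ_n L`: these
already form a normal subloop. -/
theorem mem_isolator_gamma_iff {n : ℕ} (hn : 1 ≤ n) {x : L} :
    x ∈ (gamma L n).isolator ↔ ∃ w : LoopWord, w.degree ≠ 0 ∧ w.eval x ∈ gamma L n := by
  refine ⟨fun hx => ?_, fun h => Subloop.subset_normalClosure _ h⟩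
  set T : Set L := {x | ∃ w : LoopWord, w.degree ≠ 0 ∧ w.eval x ∈ gamma L n} with hT
  have hF := isRelativeSeries_relativeSeries n T
  have hG := hF.isRelativeSeries_torsion fun _ h => h
  have step : ∀ k, ∃ w : LoopWord, w.degree ≠ 0 ∧ w.eval x ∈ relativeSeries n T k := by
    intro k
    induction k with
    | zero =>
      exact ⟨.letter, one_ne_zero, Subloop.normalClosure_le (hF.normal 0) hF.subset hx⟩
    | succ k ih =>
      obtain ⟨w, hw, h⟩ := ih
      obtain ⟨-, v, hv, h⟩ := hG.relativeSeries_le k h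
      refine ⟨v.comp w, ?_, by rwa [LoopWord.eval_comp]⟩
      rw [LoopWord.degree_comp]
      exact mul_ne_zero hv hw
  obtain ⟨w, hw, h⟩ := step n
  refine ⟨w, hw, ?_⟩
  have := (isRelativeSeries_gamma hn T).relativeSeries_le n h
  rwa [min_eq_right (by omega)] at this

end Loop

/-! ### Brackets of elements of isolators -/

namespace Subloop

variable {L : Type u} [Loop L]

/-- The intersection of two subloops. -/
instance : Min (Subloop L) where
  min M N :=
    { carrier := {x | x ∈ M ∧ x ∈ N}
      one_mem' := ⟨M.one_mem', N.one_mem'⟩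
      mul_mem' := fun ha hb => ⟨M.mul_mem' ha.1 hb.1, N.mul_mem' ha.2 hb.2⟩
      ldiv_mem' := fun ha hb => ⟨M.ldiv_mem' ha.1 hb.1, N.ldiv_mem' ha.2 hb.2⟩
      rdiv_mem' := fun ha hb => ⟨M.rdiv_mem' ha.1 hb.1, N.rdiv_mem' ha.2 hb.2⟩ }

theorem le_isolator (K : Subloop L) : K ≤ K.isolator :=
  fun _ hx => subset_normalClosure _ ⟨.letter, one_ne_zero, hx⟩

theorem isNormal_isolator (K : Subloop L) : K.isolator.IsNormal := isNormal_normalClosure _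

theorem isolator_mono {K M : Subloop L} (h : K ≤ M) : K.isolator ≤ M.isolator :=
  normalClosure_le (isNormal_isolator M) fun _ ⟨w, hw, hx⟩ =>
    subset_normalClosure _ ⟨w, hw, h hx⟩

end Subloop

namespace Loop

variable {L : Type u} [Loop L]

theorem isolator_gamma_antitone : Antitone fun n => (gamma L n).isolator :=
  fun _ _ h => Subloop.isolator_mono (gamma_antitone L h)

theorem mem_isolator_gamma_one (x : L) : x ∈ (gamma L 1).isolator :=
  Subloop.le_isolator _ (mem_gamma_one x)

/-- `L / √γ_n L` is torsion-free. -/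
theorem mem_isolator_gamma_of_eval {n : ℕ} (hn : 1 ≤ n) {x : L} {w : LoopWord}
    (hw : w.degree ≠ 0) (h : w.eval x ∈ (gamma L n).isolator) : x ∈ (gamma L n).isolator := by
  obtain ⟨v, hv, h⟩ := (mem_isolator_gamma_iff hn).1 h
  refine (mem_isolator_gamma_iff hn).2 ⟨v.comp w, ?_, by rwa [LoopWord.eval_comp]⟩
  rw [LoopWord.degree_comp]
  exact mul_ne_zero hv hw

/-- A map that is multiplicative modulo `√γ_n L` on a subloop takes `x` into `√γ_n L` as soon as
it does so for some `w(x)` with `w` of non-zero degree. -/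
theorem mem_isolator_gamma_of_map {n : ℕ} (hn : 1 ≤ n) (P : Subloop L) (f : L → L)
    (hf : ∀ x ∈ P, ∀ y ∈ P, (Subloop.isNormal_isolator (gamma L n)).proj (f (x * y)) =
      (Subloop.isNormal_isolator (gamma L n)).proj (f x) *
        (Subloop.isNormal_isolator (gamma L n)).proj (f y))
    {x : L} (hx : x ∈ P) {w : LoopWord} (hw : w.degree ≠ 0)
    (h : f (w.eval x) ∈ (gamma L n).isolator) : f x ∈ (gamma L n).isolator := by
  have hK := Subloop.isNormal_isolator (gamma L n)
  refine mem_isolator_gamma_of_eval hn hw ?_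
  rw [← hK.proj_eq_one, w.proj_eval hK, ← (w.map_eval P (fun x => hK.proj (f x)) hf hx).2,
    hK.proj_eq_one]
  exact h

/-- The bracket condition for the deviations of level `l`, with entries in the isolators. Since it
is clear when `l + 3 ≥ n`, it can be proved by descending induction on the level: the condition for
level `l + 1` says that deviations of level `l` are multiplicative modulo `√γ_n L` in each
argument, so that the entries in `√γ_p L` can be replaced by entries in `γ_p L` one by one. -/
theorem deviation_mem_isolator_gamma {n : ℕ} (hn : 1 ≤ n) (d : ℕ) :
    ∀ (l : ℕ), n ≤ l + 3 + d → ∀ (α : DeviationIndex l) (p : Fin (l + 3) → ℕ)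
      (a : Fin (l + 3) → L), (∀ i, 1 ≤ p i) → n ≤ ∑ i, p i →
      (∀ i, a i ∈ (gamma L (p i)).isolator) → deviation l α a ∈ (gamma L n).isolator := by
  induction d with
  | zero =>
    intro l hl α p a _ _ _
    exact Subloop.le_isolator _
      (deviation_mem_gamma α (p := fun _ => 1) (fun _ => le_rfl) (by simpa using hl)
        fun i => mem_gamma_one (a i))
  | succ d ih =>
    intro l hl α p a hp hs ha
    have hK := Subloop.isNormal_isolator (gamma L n)
    -- The entries outside `s` have already been moved from `√γ_(p i) L` to `γ_(p i) L`.
    have key : ∀ (s : Finset (Fin (l + 3))) (a : Fin (l + 3) → L),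
        (∀ i, a i ∈ (gamma L (p i)).isolator) → (∀ i, i ∉ s → a i ∈ gamma L (p i)) →
        deviation l α a ∈ (gamma L n).isolator := by
      intro s
      induction s using Finset.induction_on with
      | empty =>
        intro a _ ha
        exact Subloop.le_isolator _ (deviation_mem_gamma α hp hs fun i => ha i (by simp))
      | insert i s his ihs =>
        intro a ha has
        obtain ⟨w, hw, hwa⟩ := (mem_isolator_gamma_iff (hp i)).1 (ha i)
        have := mem_isolator_gamma_of_map hn (gamma L (p i)).isolator
          (fun x => deviation l α (Function.update a i x)) ?_ (ha i) hw ?_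
        · simpa only [Function.update_eq_self] using this
        · intro x hx y _
          refine hK.proj_deviation_mul l α a i x y fun β => ?_
          refine ih (l + 1) (by omega) β (i.succ.insertNth (α := fun _ => ℕ) 1 p) _ ?_ ?_ ?_
          · rw [Fin.forall_iff_succAbove i.succ]
            simpa only [Fin.insertNth_apply_succAbove, Fin.insertNth_apply_same] using
              ⟨le_rfl, hp⟩
          · rw [Fin.sum_univ_succAbove _ i.succ]
            simp only [Fin.insertNth_apply_succAbove, Fin.insertNth_apply_same]
            omega
          · rw [Fin.forall_iff_succAbove i.succ]
            simp only [Fin.insertNth_apply_succAbove, Fin.insertNth_apply_same]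
            refine ⟨mem_isolator_gamma_one y, fun j => ?_⟩
            by_cases h : j = i
            · subst h
              rwa [Function.update_self]
            · rw [Function.update_of_ne h]
              exact ha j
        · refine ihs _ (fun j => ?_) fun j hj => ?_
          · by_cases h : j = i
            · subst h
              rw [Function.update_self]
              exact LoopWord.eval_mem _ (ha j) w
            · rw [Function.update_of_ne h]
              exact ha j
          · by_cases h : j = i
            · subst h
              rwa [Function.update_self]
            · rw [Function.update_of_ne h]
              exact has j (by simp [h, hj])
    exact key Finset.univ a ha fun i hi => absurd (Finset.mem_univ i) hi

theorem associator_mem_isolator_gamma {n p q : ℕ} (hn : 1 ≤ n) (hp : 1 ≤ p) (hq : 1 ≤ q)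
    (h : n ≤ p + q) (a : Fin 3 → L) (i j : Fin 3) (hij : i ≠ j)
    (hi : a i ∈ (gamma L p).isolator) (hj : a j ∈ (gamma L q).isolator) :
    associator (a 0) (a 1) (a 2) ∈ (gamma L n).isolator := by
  refine deviation_mem_isolator_gamma hn n 0 (by omega) finZeroElim
    (Function.update (Function.update 1 j q) i p) a (fun m => ?_) ?_ fun m => ?_
  · by_cases h1 : m = i
    · subst h1; simpa using hp
    · by_cases h2 : m = j
      · subst h2; simpa [h1] using hq
      · simp [h1, h2]
  · rw [Fin.sum_univ_three]
    clear hi hj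
    fin_cases i <;> fin_cases j <;> simp [Function.update] at hij ⊢ <;> omega
  · by_cases h1 : m = i
    · subst h1; simpa using hi
    · by_cases h2 : m = j
      · subst h2; simpa [h1] using hj
      · simpa [h1, h2] using mem_isolator_gamma_one (a m)

/-- The bracket condition for commutators with one entry in `γ_p L` and the other one in an isolator,
by descending induction on `p`. Modulo `√γ_n L`, the obstruction to multiplicativity of `z ↦ [z, b]`
is `[[z, b], z']`, where `[z, b]` lies in `γ_{p+1} L`. -/
theorem commutator_mem_isolator_gamma_left {n : ℕ} (hn : 1 ≤ n) (d : ℕ) :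
    ∀ p q : ℕ, 1 ≤ p → 1 ≤ q → n ≤ p + d → n ≤ p + q → ∀ b ∈ gamma L p,
      ∀ z ∈ (gamma L q).isolator, commutator z b ∈ (gamma L n).isolator := by
  have hK := Subloop.isNormal_isolator (gamma L n)
  induction d with
  | zero =>
    intro p q _ _ hd _ b hb z _
    exact hK.commutator_mem _ _ (Or.inr (Subloop.le_isolator _ (gamma_antitone L hd hb)))
  | succ d ih =>
    intro p q hp hq hd hpq b hb z hz
    obtain ⟨w, hw, hwz⟩ := (mem_isolator_gamma_iff hq).1 hz
    refine mem_isolator_gamma_of_map hn (gamma L q).isolator (fun x => commutator x b)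
      (fun x hx y hy => ?_) hz hw ?_
    · refine hK.proj_commutator_mul (Subloop.isNormal_isolator (gamma L q))
        (Subloop.isNormal_isolator (gamma L p))
        (associator_mem_isolator_gamma hn hq hp (by omega)) hx hy (Subloop.le_isolator _ hb) ?_
      rw [hK.commutator_mem_comm]
      exact ih (p + 1) q (by omega) hq (by omega) (by omega) _
        (commutator_mem_gamma le_rfl hp (by omega) (mem_gamma_one x) hb) y hy
    · exact Subloop.le_isolator _ (commutator_mem_gamma hq hp (by omega) hwz hb)

/-- The bracket condition for commutators, by descending induction on the auxiliary term `γ_i L`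
containing the first entry. The obstruction to multiplicativity of `x ↦ [x, z]` modulo `√γ_n L` is
`[[x, z], x']`, where `[x, z]` lies in `√γ_q L` and in `γ_{i+1} L`. -/
theorem commutator_mem_isolator_gamma_of_mem {n : ℕ} (hn : 1 ≤ n) (d : ℕ) :
    ∀ i p q : ℕ, 1 ≤ i → 1 ≤ p → 1 ≤ q → n ≤ i + d → n ≤ p + q →
      ∀ x ∈ (gamma L p).isolator, x ∈ gamma L i →
      ∀ z ∈ (gamma L q).isolator, commutator x z ∈ (gamma L n).isolator := by
  have hK := Subloop.isNormal_isolator (gamma L n)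
  induction d with
  | zero =>
    intro i p q _ _ _ hd _ x _ hx z _
    exact hK.commutator_mem _ _ (Or.inl (Subloop.le_isolator _ (gamma_antitone L hd hx)))
  | succ d ih =>
    intro i p q hi hp hq hd hpq x hx hxi z hz
    obtain ⟨w, hw, hwx⟩ := (mem_isolator_gamma_iff hp).1 hx
    refine mem_isolator_gamma_of_map hn ((gamma L p).isolator ⊓ gamma L i)
      (fun x => commutator x z) (fun x hx y hy => ?_) ⟨hx, hxi⟩ hw ?_
    · have hq' := Subloop.isNormal_isolator (gamma L q)
      exact hK.proj_commutator_mul (Subloop.isNormal_isolator (gamma L p)) hq'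
        (associator_mem_isolator_gamma hn hp hq hpq) hx.1 hy.1 hz
        (ih (i + 1) q p (by omega) hq hp (by omega) (by omega) _
          (hq'.commutator_mem x z (Or.inr hz))
          (commutator_mem_gamma hi le_rfl le_rfl hx.2 (mem_gamma_one z)) y hy.1)
    · rw [hK.commutator_mem_comm]
      exact commutator_mem_isolator_gamma_left hn n p q hp hq (by omega) hpq _ hwx z hz

end Loop

/-- Expressions in which indeterminates may occur repeatedly, or not at all, also respect
weights, which are then counted with multiplicity; this is what makes an induction on the
expression possible. -/
theorem BracketTerm.eval_mem_isolator_gamma {L : Type u} [Loop L] {n : ℕ} {p : Fin n → ℕ}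
    (hp : ∀ i, 1 ≤ p i) {x : Fin n → L} (hx : ∀ i, x i ∈ (Loop.gamma L (p i)).isolator)
    (t : BracketTerm (Fin n)) :
    1 ≤ ∑ i, t.occurrences i * p i ∧
      t.eval x ∈ (Loop.gamma L (∑ i, t.occurrences i * p i)).isolator := by
  induction t with
  | var j => simpa [occurrences, eval] using ⟨hp j, hx j⟩
  | commutator s t hs ht =>
    simp only [occurrences, add_mul, Finset.sum_add_distrib]
    exact ⟨by omega, Loop.commutator_mem_isolator_gamma_of_mem (by omega) _ 1 _ _ le_rfl hs.1 ht.1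
      (Nat.le_add_left _ _) le_rfl _ hs.2 (Loop.mem_gamma_one _) _ ht.2⟩
  | deviation l α t ih =>
    simp only [occurrences, Finset.sum_mul]
    rw [Finset.sum_comm]
    have h : 1 ≤ ∑ j, ∑ i, (t j).occurrences i * p i :=
      (ih 0).1.trans (Finset.single_le_sum (f := fun j => ∑ i, (t j).occurrences i * p i)
        (fun _ _ => Nat.zero_le _) (Finset.mem_univ 0))
    exact ⟨h, Loop.deviation_mem_isolator_gamma h _ l (Nat.le_add_left _ _) α _ _
      (fun j => (ih j).1) le_rfl fun j => (ih j).2⟩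

theorem mainTheorem3 {L : Type u} [Loop L] :
    Loop.IsNSequence (fun n : ℕ => (Loop.gamma L n).isolator) where
  normal n _ := Subloop.isNormal_isolator _
  one_eq := le_antisymm (fun _ _ => trivial) fun x _ => Loop.mem_isolator_gamma_one x
  succ_le n _ := Loop.isolator_gamma_antitone n.le_succ
  bracket_mem n t ht p hp x hx := by
    have h := (t.eval_mem_isolator_gamma hp hx).2
    simpa only [show ∀ i, t.occurrences i = 1 from ht, one_mul] using h
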